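/- All graphs are simple and $\log$ is the logarithm to base $2$. For a graph $H$, an integer $n\ge 0$ and a real number $x$, let $\mathrm{RT}(n,H,x)$ be the maximum number of edges of an $H$-free graph on $n$ vertices with independence number less than $x$ (and $0$ if there is no such graph). For a function $g:\mathbb N\to\mathbb R$ let $$\overline{\mathrm{RT}}(H,g)=\limsup_{n\to\infty}\frac{\mathrm{RT}(n,H,g(n))}{n^2},\qquad \underline{\mathrm{RT}}(H,g)=\liminf_{n\to\infty}\frac{\mathrm{RT}(n,H,g(n))}{n^2},$$ and, if the two are equal, denote their common value by $\mathrm{RT}(H,g)$. For integers $t\ge 2$, $n\ge 0$ let $Q(t,n)$ be the minimum independence number of a $K_t$-free graph on $n$ vertices. **Theorem.** Let $p\ge 2$ and $q\ge 2$ be integers, let $\omega:\mathbb N\to\mathbb R$ be any function with $\omega(n)\to\infty$, and let $f(n)=n\,2^{-\omega(n)(\log n)^{1-1/q}}$. Then: (a) With respect to the function $n\mapsto Q(p,\lceil f(n)\rceil)$, $$\overline{\mathrm{RT}}\bigl(K_{pq},\,Q(p,\lceil f\rceil)\bigr)\le \frac12\Bigl(1-\frac1{q-1}\Bigr).$$ (b)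 Let $0\le i\le p-1$ and $t=\bigl\lfloor\frac{pq-i-1}{q-1}\bigr\rfloor$. Then $t\ge p$, and for every function $g:\mathbb N\to\mathbb R$ such that $$Q\Bigl(t+1,\Bigl\lfloor\frac{n}{q-1}\Bigr\rfloor\Bigr)< g(n)\le Q\bigl(p,\lceil f(n)\rceil\bigr)$$ for all sufficiently large $n$, the Ramsey–Turán density $\mathrm{RT}(K_{pq-i},g)$ exists and $$\mathrm{RT}(K_{pq-i},g)=\frac12\Bigl(1-\frac1{q-1}\Bigr).$$ -/

import Mathlib

namespace RamseyTuran

/-- The largest number of edges of an `H`-free graph on `n` vertices whose independence number is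
less than `x`. The set of edge counts is finite; if there is no such graph, the value is `0`. -/
noncomputable def maxEdges {W : Type} (n : ℕ) (H : SimpleGraph W) (x : ℝ) : ℕ :=
  sSup {e : ℕ | ∃ G : SimpleGraph (Fin n),
    H.Free G ∧ (G.indepNum : ℝ) < x ∧ G.edgeSet.ncard = e}

/-- The upper Ramsey–Turán density of `H` with respect to `f`. The sequence has values in
`[0, 1/2]`, so the real `limsup` is the usual one. -/
noncomputable def upperDensity {W : Type} (H : SimpleGraph W) (f : ℕ → ℝ) : ℝ :=
  Filter.limsup (fun n : ℕ => (maxEdges n H (f n) : ℝ) / (n : ℝ) ^ 2) Filter.atTop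

/-- The lower Ramsey–Turán density of `H` with respect to `f`. -/
noncomputable def lowerDensity {W : Type} (H : SimpleGraph W) (f : ℕ → ℝ) : ℝ :=
  Filter.liminf (fun n : ℕ => (maxEdges n H (f n) : ℝ) / (n : ℝ) ^ 2) Filter.atTop

/-- The Ramsey–Turán density of `H` with respect to `f` exists and equals `c`. -/
def HasDensity {W : Type} (H : SimpleGraph W) (f : ℕ → ℝ) (c : ℝ) : Prop :=
  upperDensity H f = c ∧ lowerDensity H f = c

/-- The complete graph on `s` vertices. -/
abbrev K (s : ℕ) : SimpleGraph (Fin s) := ⊤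

/-- The inverse Ramsey function: the minimum independence number of a graph on `n` vertices that
contains no clique on `t` vertices. -/
noncomputable def Q (t n : ℕ) : ℕ :=
  sInf {a : ℕ | ∃ G : SimpleGraph (Fin n), G.CliqueFree t ∧ G.indepNum = a}

/-- The function `n · 2 ^ (-ω(n) (log₂ n) ^ (1 - 1/q))`. -/
noncomputable def scale (q : ℕ) (ω : ℕ → ℝ) (n : ℕ) : ℝ :=
  (n : ℝ) * (2 : ℝ) ^ (-(ω n * (Real.logb 2 (n : ℝ)) ^ (1 - 1 / (q : ℝ))))

end RamseyTuran

/-!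
Upper bound. A graph on `n` vertices with more than `(1/2)(1 - 1/(q-1)) n² + ε n²` edges contains
a positive proportion of all possible `q`-cliques. Suppose that a proportion `d` of the
`(k+1)`-tuples are cliques. Pick `s` random `k`-tuples and let `U` be the set of vertices
extending all of them to cliques: by convexity `U` has on average at least `n dˢ` vertices, while
`p` vertices with only a proportion `d'` of common extensions all lie in `U` with probability at
most `d'ˢ`. Hence, after deleting a vertex from every bad `p`-set, `U` is still larger than `f n`,
so it contains a `p`-clique `T`, and a proportion `d'` of the `k`-tuples are cliques joined
completely to `T`. Iterating from `k + 1 = q` down to `1` yields a clique on `p q` vertices. With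
`L = log n` the proportions are `2 ^ (-c L ^ (1 - k/q))`, and in each round `U` retains
`n 2 ^ (-O(L ^ (1 - 1/q)))` vertices, more than `f n`.

Lower bound. Join `q - 1` copies of a graph `B` attaining `Q (t + 1) ⌊n/(q-1)⌋` completely. Since
`n` need not be divisible by `q - 1`, the copies other than the last may receive an extra vertex, a
twin of a vertex `u`. Choose `w` not adjacent to `u`. The joins around the twins are thinned so
that a clique using both twins of one copy has only neighbours of `w` in the next one, where it
loses again what it gained. An independent set meeting two copies has a single vertex in the first
of them, and `u` or `w` can replace this vertex in the second.
-/

namespace RamseyTuran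

open Finset Filter
open scoped Topology

section DependentRandomChoice

variable {ι V Y : Type*}

theorem sum_card_filter_forall_mem [Fintype Y] [DecidableEq Y] (I : Finset ι) (A : ι → Finset Y)
    (s : ℕ) : ∑ x : Fin s → Y, #{i ∈ I | ∀ j, x j ∈ A i} = ∑ i ∈ I, #(A i) ^ s := by
  have hfiber (i : ι) : #{x : Fin s → Y | ∀ j, x j ∈ A i} = #(A i) ^ s := by
    rw [← Fintype.card_piFinset_const]
    congr 1
    ext x
    simp
  rw [← sum_congr rfl fun i _ => hfiber i]
  exact sum_card_bipartiteAbove_eq_sum_card_bipartiteBelow _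

theorem card_mul_pow_le_sum_pow {I : Finset ι} {f : ι → ℝ} {a : ℝ} (ha : 0 ≤ a)
    (hf : ∀ i ∈ I, 0 ≤ f i) (h : #I * a ≤ ∑ i ∈ I, f i) (s : ℕ) :
    #I * a ^ s ≤ ∑ i ∈ I, f i ^ s := by
  rcases I.eq_empty_or_nonempty with rfl | hI
  · simp
  cases s with
  | zero => simp
  | succ s =>
    have : (0 : ℝ) < #I := by exact_mod_cast hI.card_pos
    calc #I * a ^ (s + 1) = (#I * a) ^ (s + 1) / #I ^ s := by
          rw [eq_div_iff (by positivity)]; ring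
      _ ≤ (∑ i ∈ I, f i) ^ (s + 1) / #I ^ s := by gcongr
      _ ≤ ∑ i ∈ I, f i ^ (s + 1) := pow_sum_div_card_le_sum_pow hf s

theorem card_mul_pow_le_sum_card_filter_forall_mem [Fintype Y] [DecidableEq Y] {I : Finset ι}
    {A : ι → Finset Y} {a : ℝ} (ha : 0 ≤ a) (h : #I * a ≤ ∑ i ∈ I, (#(A i) : ℝ)) (s : ℕ) :
    #I * a ^ s ≤ ∑ x : Fin s → Y, (#{i ∈ I | ∀ j, x j ∈ A i} : ℝ) := by
  have hmoment : ∑ x : Fin s → Y, (#{i ∈ I | ∀ j, x j ∈ A i} : ℝ) = ∑ i ∈ I, (#(A i) : ℝ) ^ s := by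
    exact_mod_cast sum_card_filter_forall_mem I A s
  rw [hmoment]
  exact card_mul_pow_le_sum_pow ha (fun _ _ => by positivity) h s

theorem sum_card_filter_forall_mem_le [Fintype Y] [DecidableEq Y] {I : Finset ι}
    {A : ι → Finset Y} {a : ℝ} (h : ∀ i ∈ I, (#(A i) : ℝ) ≤ a) (s : ℕ) :
    ∑ x : Fin s → Y, (#{i ∈ I | ∀ j, x j ∈ A i} : ℝ) ≤ #I * a ^ s := by
  have hmoment : ∑ x : Fin s → Y, (#{i ∈ I | ∀ j, x j ∈ A i} : ℝ) = ∑ i ∈ I, (#(A i) : ℝ) ^ s := by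
    exact_mod_cast sum_card_filter_forall_mem I A s
  rw [hmoment, ← nsmul_eq_mul]
  exact sum_le_card_nsmul _ _ _ fun i hi => by gcongr; exact h i hi

theorem exists_subset_forall_not_subset (U : Finset V) {B : Finset (Finset V)}
    (hB : ∀ T ∈ B, T.Nonempty) :
    ∃ U' ⊆ U, #U ≤ #U' + #B ∧ ∀ T ∈ B, ¬ T ⊆ U' := by
  classical
  choose v hv using hB
  let R : Finset V := B.attach.image fun T => v T.1 T.2
  refine ⟨U \ R, sdiff_subset, ?_, fun T hT hTU => ?_⟩
  · have hdiff := le_card_sdiff R U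
    have hR : #R ≤ #B := card_image_le.trans_eq card_attach
    omega
  · exact (mem_sdiff.mp (hTU (hv T hT))).2 (mem_image_of_mem _ (mem_attach B ⟨T, hT⟩))

theorem exists_subset_forall_exists_common_subset [Fintype V] [Fintype Y] [Nonempty Y]
    (D : V → Finset Y) {p s : ℕ} (hp : p ≠ 0) {δ δ' m : ℝ} (hδ : 0 ≤ δ) (hδ' : 0 ≤ δ')
    (hD : δ * (Fintype.card V * Fintype.card Y) ≤ ∑ v, (#(D v) : ℝ))
    (hm : m + (Fintype.card V).choose p * δ' ^ s ≤ Fintype.card V * δ ^ s) :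
    ∃ U : Finset V, m ≤ #U ∧
      ∀ T ⊆ U, #T = p → ∃ C : Finset Y, δ' * Fintype.card Y ≤ #C ∧ ∀ v ∈ T, C ⊆ D v := by
  classical
  set N : ℝ := (Fintype.card Y : ℝ)
  let common (T : Finset V) : Finset Y := {y | ∀ v ∈ T, y ∈ D v}
  let bad : Finset (Finset V) := {T ∈ powersetCard p univ | (#(common T) : ℝ) < δ' * N}
  let U (x : Fin s → Y) : Finset V := {v | ∀ j, x j ∈ D v}
  let badIn (x : Fin s → Y) : Finset (Finset V) := {T ∈ bad | ∀ j, x j ∈ common T}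
  have hU : Fintype.card V * (δ * N) ^ s ≤ ∑ x, (#(U x) : ℝ) :=
    card_mul_pow_le_sum_card_filter_forall_mem (I := univ) (by positivity)
      (by rw [card_univ]; linarith) s
  have hbadIn : ∑ x, (#(badIn x) : ℝ) ≤ (Fintype.card V).choose p * (δ' * N) ^ s := by
    refine (sum_card_filter_forall_mem_le (fun T hT => (mem_filter.mp hT).2.le) s).trans ?_
    gcongr
    exact (card_filter_le _ _).trans (card_powersetCard p univ).le
  obtain ⟨x, -, hx⟩ : ∃ x ∈ univ, m ≤ #(U x) - #(badIn x) := by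
    refine exists_le_of_sum_le univ_nonempty ?_
    have hscaled := mul_le_mul_of_nonneg_right hm (by positivity : 0 ≤ N ^ s)
    simp only [sum_sub_distrib, sum_const, card_univ, Fintype.card_fun, Fintype.card_fin,
      nsmul_eq_mul, Nat.cast_pow, mul_pow] at hU hbadIn ⊢
    linarith
  have hnonempty : ∀ T ∈ badIn x, T.Nonempty := fun T hT =>
    card_pos.mp ((mem_powersetCard.mp (mem_filter.mp (mem_filter.mp hT).1).1).2 ▸ hp.bot_lt)
  obtain ⟨U', hU', hcard, havoid⟩ := exists_subset_forall_not_subset (U x) hnonempty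
  refine ⟨U', ?_, fun T hT hTp => ?_⟩
  · have hcard' : (#(U x) : ℝ) ≤ #U' + #(badIn x) := by exact_mod_cast hcard
    linarith
  · refine ⟨common T, ?_, fun v hv y hy => (mem_filter.mp hy).2 v hv⟩
    by_contra! hlt
    refine havoid T (mem_filter.mpr ⟨mem_filter.mpr ⟨?_, hlt⟩, fun j => ?_⟩) hT
    · exact mem_powersetCard.mpr ⟨subset_univ T, hTp⟩
    · exact mem_filter.mpr ⟨mem_univ _, fun v hv => (mem_filter.mp (hU' (hT hv))).2 j⟩

end DependentRandomChoice

section CliqueTuples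

variable {V : Type*} {G : SimpleGraph V}

theorem isNClique_union [DecidableEq V] {p k : ℕ} {S T : Finset V} (hS : G.IsNClique p S)
    (hT : G.IsNClique k T) (hST : ∀ v ∈ S, ∀ w ∈ T, G.Adj v w) :
    G.IsNClique (p + k) (S ∪ T) := by
  refine ⟨?_, ?_⟩
  · have := G.symm
    rw [SimpleGraph.isClique_iff, coe_union, Set.pairwise_union_of_symm]
    exact ⟨hS.isClique, hT.isClique, fun v hv w hw _ => hST v hv w hw⟩
  · have hdisj : Disjoint S T := disjoint_left.mpr fun v hv hv' => (hST v hv v hv').ne rfl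
    rw [card_union_of_disjoint hdisj, hS.card_eq, hT.card_eq]

variable [Fintype V]

open Classical in
/-- The ordered `k`-cliques of `G` with all vertices in `W`. Their number is compared with
`Fintype.card V ^ k`, the number of all `k`-tuples of vertices. -/
noncomputable def cliqueTuples (G : SimpleGraph V) (k : ℕ) (W : Finset V) :
    Finset (Fin k → V) :=
  {x | (∀ i, x i ∈ W) ∧ Pairwise fun i j => G.Adj (x i) (x j)}

theorem mem_cliqueTuples {k : ℕ} {W : Finset V} {x : Fin k → V} :
    x ∈ cliqueTuples G k W ↔ (∀ i, x i ∈ W) ∧ Pairwise fun i j => G.Adj (x i) (x j) := by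
  simp [cliqueTuples]

theorem cliqueTuples_subset {k : ℕ} {W W' : Finset V} (h : W ⊆ W') :
    cliqueTuples G k W ⊆ cliqueTuples G k W' := fun x hx => by
  rw [mem_cliqueTuples] at hx ⊢
  exact ⟨fun i => h (hx.1 i), hx.2⟩

theorem cons_mem_cliqueTuples [DecidableRel G.Adj] {k : ℕ} {W : Finset V} {v : V} {y : Fin k → V} :
    (Fin.cons v y : Fin (k + 1) → V) ∈ cliqueTuples G (k + 1) W ↔
      v ∈ W ∧ y ∈ cliqueTuples G k {w ∈ W | G.Adj v w} := by
  simp only [mem_cliqueTuples, Pairwise, Fin.forall_fin_succ, Fin.cons_zero, Fin.cons_succ,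
    mem_filter, forall_and, ne_eq, Fin.succ_inj, Fin.succ_ne_zero, (Fin.succ_ne_zero _).symm,
    not_true_eq_false, not_false_eq_true, false_imp_iff, true_imp_iff, true_and, G.adj_comm _ v]
  tauto

theorem card_cliqueTuples_zero (W : Finset V) : #(cliqueTuples G 0 W) = 1 := by
  simp [cliqueTuples, Pairwise]

theorem card_cliqueTuples_succ [DecidableEq V] (k : ℕ) (W : Finset V) :
    #(cliqueTuples G (k + 1) W) =
      ∑ v, #{y : Fin k → V | (Fin.cons v y : Fin (k + 1) → V) ∈ cliqueTuples G (k + 1) W} := by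
  rw [card_eq_sum_card_fiberwise (f := fun x => x 0) (t := univ) (by simp)]
  refine sum_congr rfl fun v _ => (card_nbij' (Fin.cons v) Fin.tail ?_ ?_ ?_ ?_).symm
  · intro y hy
    simpa using hy
  · intro x hx
    obtain ⟨hmem, rfl⟩ := by simpa using hx
    simpa [Fin.cons_self_tail] using hmem
  · exact fun y _ => Fin.tail_cons (α := fun _ => V) v y
  · intro x hx
    obtain ⟨-, rfl⟩ := by simpa using hx
    exact Fin.cons_self_tail x

theorem card_cliqueTuples_succ_eq_sum [DecidableRel G.Adj] (k : ℕ) (W : Finset V) :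
    #(cliqueTuples G (k + 1) W) = ∑ v ∈ W, #(cliqueTuples G k {w ∈ W | G.Adj v w}) := by
  classical
  rw [card_cliqueTuples_succ, ← sum_subset (subset_univ W)]
  · refine sum_congr rfl fun v hv => ?_
    simp [cons_mem_cliqueTuples, hv]
  · intro v _ hv
    simp [cons_mem_cliqueTuples, hv]

theorem exists_isNClique_le_card_cliqueTuples [Nonempty V] [DecidableRel G.Adj] {p m k s : ℕ}
    (hp : p ≠ 0) (hG : ∀ U : Finset V, m ≤ #U → ∃ T ⊆ U, G.IsNClique p T) {δ δ' : ℝ} (hδ : 0 ≤ δ)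
    (hδ' : 0 < δ')
    (hm : m + (Fintype.card V).choose p * δ' ^ s ≤ Fintype.card V * δ ^ s) {W : Finset V}
    (hW : δ * Fintype.card V ^ (k + 1) ≤ #(cliqueTuples G (k + 1) W)) :
    ∃ T ⊆ W, G.IsNClique p T ∧
      δ' * Fintype.card V ^ k ≤ #(cliqueTuples G k {w ∈ W | ∀ v ∈ T, G.Adj v w}) := by
  classical
  let D (v : V) : Finset (Fin k → V) :=
    {y | (Fin.cons v y : Fin (k + 1) → V) ∈ cliqueTuples G (k + 1) W}
  have hcard : (Fintype.card (Fin k → V) : ℝ) = Fintype.card V ^ k := by simp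
  have hD : δ * (Fintype.card V * Fintype.card (Fin k → V)) ≤ ∑ v, (#(D v) : ℝ) := by
    rw [hcard, ← pow_succ']
    exact hW.trans_eq (by exact_mod_cast card_cliqueTuples_succ k W)
  obtain ⟨U, hmU, hU⟩ := exists_subset_forall_exists_common_subset D hp hδ hδ'.le hD hm
  obtain ⟨T, hTU, hT⟩ := hG U (Nat.cast_le.mp hmU)
  obtain ⟨C, hC, hCD⟩ := hU T hTU hT.card_eq
  rw [hcard] at hC
  have hmem {v : V} (hv : v ∈ T) {y : Fin k → V} (hy : y ∈ C) :
      v ∈ W ∧ y ∈ cliqueTuples G k {w ∈ W | G.Adj v w} :=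
    cons_mem_cliqueTuples.mp ((mem_filter_univ y).mp (hCD v hv hy))
  refine ⟨T, fun v hv => ?_, hT, hC.trans ?_⟩
  · have hpos : (0 : ℝ) < #C := lt_of_lt_of_le (by positivity) hC
    obtain ⟨y, hy⟩ := card_pos.mp (Nat.cast_pos.mp hpos)
    exact (hmem hv hy).1
  · obtain ⟨v₀, hv₀⟩ : T.Nonempty := card_pos.mp (hT.card_eq ▸ hp.bot_lt)
    refine Nat.cast_le.mpr (card_le_card fun y hy => ?_)
    have hclique {v : V} (hv : v ∈ T) := mem_cliqueTuples.mp (hmem hv hy).2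
    simp only [mem_cliqueTuples, mem_filter] at hclique ⊢
    exact ⟨fun i => ⟨((hclique hv₀).1 i).1, fun v hv => ((hclique hv).1 i).2⟩, (hclique hv₀).2⟩

theorem exists_isNClique_mul_of_le_card_cliqueTuples [Nonempty V] {p m q : ℕ} (hp : p ≠ 0)
    (hG : ∀ U : Finset V, m ≤ #U → ∃ T ⊆ U, G.IsNClique p T) {d : ℕ → ℝ} (hd : ∀ k, 0 < d k)
    (hstep : ∀ k, ∃ s : ℕ,
      m + (Fintype.card V).choose p * d k ^ s ≤ Fintype.card V * d (k + 1) ^ s)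
    {W : Finset V} (hW : d q * Fintype.card V ^ q ≤ #(cliqueTuples G q W)) :
    ∃ T ⊆ W, G.IsNClique (p * q) T := by
  classical
  induction q generalizing W with
  | zero => exact ⟨∅, empty_subset W, by simp⟩
  | succ k ih =>
    obtain ⟨s, hs⟩ := hstep k
    obtain ⟨T, hTW, hT, hcount⟩ :=
      exists_isNClique_le_card_cliqueTuples hp hG (hd _).le (hd k) hs hW
    obtain ⟨T', hT'W, hT'⟩ := ih hcount
    simp only [subset_iff, mem_filter] at hT'W
    refine ⟨T ∪ T', union_subset hTW fun w hw => (hT'W hw).1, ?_⟩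
    rw [mul_add_one, add_comm]
    exact isNClique_union hT hT' fun v hv w hw => (hT'W hw).2 v hv

end CliqueTuples

section Supersaturation

variable {V : Type*} {G : SimpleGraph V}

theorem sum_card_adj_eq_two_mul_ncard_edgeSet [Fintype V] [DecidableRel G.Adj] :
    ∑ v, #{w | G.Adj v w} = 2 * G.edgeSet.ncard := by
  rw [← SimpleGraph.coe_edgeFinset, Set.ncard_coe_finset, ← G.sum_degrees_eq_twice_card_edges]
  exact sum_congr rfl fun v _ => by
    rw [← G.card_neighborFinset_eq_degree, G.neighborFinset_eq_filter]

theorem sum_card_adj_insert [DecidableEq V] [DecidableRel G.Adj] {v : V} {W : Finset V}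
    (hv : v ∉ W) :
    ∑ x ∈ insert v W, #{w ∈ insert v W | G.Adj x w} =
      ∑ x ∈ W, #{w ∈ W | G.Adj x w} + 2 * #{w ∈ W | G.Adj v w} := by
  simp only [card_filter, sum_insert hv, sum_add_distrib, G.irrefl, if_false, G.adj_comm _ v]
  ring

theorem exists_forall_mul_card_le_card_adj [Fintype V] (G : SimpleGraph V) [DecidableRel G.Adj]
    {c : ℝ} (hc : 0 ≤ c) :
    ∃ W : Finset V,
      2 * G.edgeSet.ncard ≤ c * (Fintype.card V * (Fintype.card V + 1)) + (#W : ℝ) ^ 2 ∧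
        ∀ v ∈ W, c * #W ≤ #{w ∈ W | G.Adj v w} := by
  classical
  let e (W : Finset V) : ℕ := ∑ v ∈ W, #{w ∈ W | G.Adj v w}
  -- Deleting a vertex of degree less than `c * #W` would increase this functional.
  obtain ⟨W, -, hW⟩ := exists_max_image univ (fun W : Finset V => (e W : ℝ) - c * (#W * (#W + 1)))
    univ_nonempty
  refine ⟨W, ?_, fun v hv => ?_⟩
  · have hedge : (e univ : ℝ) = 2 * G.edgeSet.ncard := by
      exact_mod_cast sum_card_adj_eq_two_mul_ncard_edgeSet
    have heW : (e W : ℝ) ≤ (#W : ℝ) ^ 2 := by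
      have : e W ≤ #W * #W := sum_le_card_nsmul _ _ _ fun v _ => card_filter_le _ _
      rw [sq]
      exact_mod_cast this
    have huniv := hW univ (mem_univ _)
    rw [card_univ, hedge] at huniv
    have : 0 ≤ c * (#W * (#W + 1)) := by positivity
    linarith
  · obtain ⟨W', hvW', rfl⟩ : ∃ W', v ∉ W' ∧ insert v W' = W :=
      ⟨W.erase v, notMem_erase v W, insert_erase hv⟩
    have herase := hW W' (mem_univ _)
    have he : (e (insert v W') : ℝ) = e W' + 2 * #{w ∈ W' | G.Adj v w} := by
      exact_mod_cast sum_card_adj_insert hvW'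
    rw [he, card_insert_of_notMem hvW'] at herase
    rw [card_insert_of_notMem hvW', filter_insert, if_neg (G.irrefl)]
    push_cast at herase ⊢
    linarith

theorem pow_succ_le_card_cliqueTuples [Fintype V] [DecidableRel G.Adj] {β η : ℝ} (hβ : 0 ≤ β)
    (hη : 0 ≤ η) {k : ℕ} {W : Finset V} (hW : ∀ v ∈ W, (#{w ∈ W | ¬ G.Adj v w} : ℝ) ≤ β)
    (hcard : η + k * β ≤ #W) :
    η ^ (k + 1) ≤ #(cliqueTuples G (k + 1) W) := by
  have hη_card : η ≤ #W := by nlinarith [mul_nonneg (Nat.cast_nonneg (α := ℝ) k) hβ]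
  induction k generalizing W with
  | zero => simpa [card_cliqueTuples_succ_eq_sum, card_cliqueTuples_zero] using hη_card
  | succ k ih =>
    rw [card_cliqueTuples_succ_eq_sum, Nat.cast_sum, pow_succ' η]
    refine (mul_le_mul_of_nonneg_right hη_card (by positivity)).trans ?_
    rw [← nsmul_eq_mul]
    refine card_nsmul_le_sum _ _ _ fun v hv => ?_
    have hsplit : (#{w ∈ W | G.Adj v w} : ℝ) + #{w ∈ W | ¬ G.Adj v w} = #W := by
      exact_mod_cast card_filter_add_card_filter_not (s := W) (G.Adj v)
    have hnbr : η + k * β ≤ #{w ∈ W | G.Adj v w} := by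
      push_cast at hcard
      linarith [hW v hv]
    refine ih (fun u hu => ?_) hnbr (by nlinarith [mul_nonneg (Nat.cast_nonneg (α := ℝ) k) hβ])
    exact (Nat.cast_le.mpr (card_le_card (filter_subset_filter _ (filter_subset _ _)))).trans
      (hW u (filter_subset _ _ hu))

theorem pow_le_card_cliqueTuples_of_le_ncard_edgeSet [Fintype V] {r : ℕ} (hr : 0 < r) {ε : ℝ}
    (hε : 0 < ε) (hV : 2 * (1 - 1 / (r : ℝ) + ε) ≤ ε * Fintype.card V)
    (hG : (1 / 2 * (1 - 1 / (r : ℝ)) + ε) * Fintype.card V ^ 2 ≤ G.edgeSet.ncard) :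
    (ε * √(ε / 2) * Fintype.card V) ^ (r + 1) ≤ #(cliqueTuples G (r + 1) univ) := by
  classical
  have hr1 : (1 : ℝ) ≤ r := by exact_mod_cast hr
  have hr_inv : 0 ≤ 1 - 1 / (r : ℝ) := sub_nonneg.mpr (div_le_one_of_le₀ hr1 (by positivity))
  set c : ℝ := 1 - 1 / (r : ℝ) + ε with hc
  have hc0 : 0 < c := by linarith
  have hV0 : (0 : ℝ) < Fintype.card V := pos_of_mul_pos_right (by linarith) hε.le
  obtain ⟨W, hW, hdeg⟩ := exists_forall_mul_card_le_card_adj G hc0.le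
  have hWV : √(ε / 2) * Fintype.card V ≤ #W := by
    refine le_of_sq_le_sq ?_ (by positivity)
    rw [mul_pow, Real.sq_sqrt (by positivity)]
    nlinarith
  have hnon : ∀ v ∈ W, (#{w ∈ W | ¬ G.Adj v w} : ℝ) ≤ (1 - c) * #W := by
    intro v hv
    have hsplit : (#{w ∈ W | G.Adj v w} : ℝ) + #{w ∈ W | ¬ G.Adj v w} = #W := by
      exact_mod_cast card_filter_add_card_filter_not (s := W) (G.Adj v)
    linarith [hdeg v hv]
  have hnon_nonneg : 0 ≤ (1 - c) * #W := by
    obtain ⟨v, hv⟩ : W.Nonempty :=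
      card_pos.mp (Nat.cast_pos.mp (lt_of_lt_of_le (by positivity) hWV))
    exact le_trans (by positivity) (hnon v hv)
  have hgreedy : ε * √(ε / 2) * Fintype.card V + r * ((1 - c) * #W) ≤ #W := by
    have hrc : r * (1 - c) = 1 - r * ε := by
      rw [hc]
      field_simp
      ring
    rw [← mul_assoc, hrc]
    nlinarith [mul_le_mul_of_nonneg_left hWV hε.le, mul_nonneg hε.le (Nat.cast_nonneg (α := ℝ) #W)]
  exact (pow_succ_le_card_cliqueTuples hnon_nonneg (by positivity) hnon hgreedy).trans
    (Nat.cast_le.mpr (card_le_card (cliqueTuples_subset (subset_univ W))))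

theorem exists_le_card_cliqueTuples {r : ℕ} (hr : 0 < r) {ε : ℝ} (hε : 0 < ε) :
    ∃ δ : ℝ, 0 < δ ∧ ∀ᶠ n : ℕ in atTop, ∀ G : SimpleGraph (Fin n),
      (1 / 2 * (1 - 1 / (r : ℝ)) + ε) * n ^ 2 ≤ G.edgeSet.ncard →
        δ * n ^ (r + 1) ≤ #(cliqueTuples G (r + 1) univ) := by
  refine ⟨(ε * √(ε / 2)) ^ (r + 1), by positivity, ?_⟩
  filter_upwards [(tendsto_natCast_atTop_atTop.const_mul_atTop hε).eventually_ge_atTop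
    (2 * (1 - 1 / (r : ℝ) + ε))] with n hn G hG
  rw [← mul_pow]
  simpa only [Fintype.card_fin] using
    pow_le_card_cliqueTuples_of_le_ncard_edgeSet (G := G) hr hε (by simpa using hn)
      (by simpa using hG)

end Supersaturation

section Scale

/-- The densities of `k`-cliques along the iteration of dependent random choice in a graph on
`2 ^ L` vertices: they increase from `2 ^ (-c * L)` at `k = 0` to the constant `2 ^ (-c)` at
`k = q`, and consecutive exponents differ by a factor `L ^ (1 / q)`. -/
noncomputable def iterDensity (c L : ℝ) (q k : ℕ) : ℝ :=
  2 ^ (-(c * L ^ (1 - (k : ℝ) / q)))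

theorem iterDensity_pos (c L : ℝ) (q k : ℕ) : 0 < iterDensity c L q k :=
  Real.rpow_pos_of_pos two_pos _

theorem iterDensity_self (c L : ℝ) {q : ℕ} (hq : q ≠ 0) : iterDensity c L q q = 2 ^ (-c) := by
  simp [iterDensity, hq]

theorem iterDensity_pow (c L : ℝ) (q k s : ℕ) :
    iterDensity c L q k ^ s = 2 ^ (-(c * (s * L ^ (1 - (k : ℝ) / q)))) := by
  rw [iterDensity, ← Real.rpow_natCast, ← Real.rpow_mul two_pos.le]
  ring_nf

theorem exists_le_iterDensity_pow {c L : ℝ} (hc : 1 ≤ c) (hL : 1 ≤ L) (b q k : ℕ) :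
    ∃ s : ℕ, (2 : ℝ) ^ (-(c * (b + 1) * L ^ (1 - 1 / (q : ℝ)))) ≤ iterDensity c L q (k + 1) ^ s ∧
      ((2 : ℝ) ^ L) ^ b * iterDensity c L q k ^ s ≤ 1 := by
  have hL0 : 0 < L := one_pos.trans_le hL
  set s : ℕ := ⌈b * L ^ ((k : ℝ) / q)⌉₊
  have hs_ge : b * L ^ ((k : ℝ) / q) ≤ s := Nat.le_ceil _
  have hs_le : (s : ℝ) ≤ (b + 1) * L ^ ((k : ℝ) / q) := by
    have hceil := (Nat.ceil_lt_add_one (by positivity : 0 ≤ b * L ^ ((k : ℝ) / q))).le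
    have hone : 1 ≤ L ^ ((k : ℝ) / q) := Real.one_le_rpow hL (by positivity)
    linarith
  refine ⟨s, ?_, ?_⟩
  · rw [iterDensity_pow]
    refine Real.rpow_le_rpow_of_exponent_le one_le_two (neg_le_neg ?_)
    rw [mul_assoc]
    refine mul_le_mul_of_nonneg_left ?_ (by linarith)
    calc s * L ^ (1 - ((k + 1 : ℕ) : ℝ) / q)
        ≤ (b + 1) * L ^ ((k : ℝ) / q) * L ^ (1 - ((k + 1 : ℕ) : ℝ) / q) := by gcongr
      _ = (b + 1) * L ^ (1 - 1 / (q : ℝ)) := by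
          rw [mul_assoc, ← Real.rpow_add hL0]
          congr 2
          push_cast
          ring
  · rw [iterDensity_pow, ← Real.rpow_natCast, ← Real.rpow_mul two_pos.le, ← Real.rpow_add two_pos]
    refine Real.rpow_le_one_of_one_le_of_nonpos one_le_two ?_
    have hLb : L * b ≤ s * L ^ (1 - (k : ℝ) / q) :=
      calc L * b = b * L ^ ((k : ℝ) / q) * L ^ (1 - (k : ℝ) / q) := by
            rw [mul_assoc, ← Real.rpow_add hL0, add_sub_cancel, Real.rpow_one, mul_comm]
        _ ≤ s * L ^ (1 - (k : ℝ) / q) := by gcongr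
    nlinarith [(by positivity : (0 : ℝ) ≤ s * L ^ (1 - (k : ℝ) / q))]

theorem tendsto_logb_two_natCast : Tendsto (fun n : ℕ => Real.logb 2 (n : ℝ)) atTop atTop :=
  (Real.tendsto_logb_atTop one_lt_two).comp tendsto_natCast_atTop_atTop

theorem eventually_ceil_scale_add_one_le {q : ℕ} (hq : q ≠ 0) {ω : ℕ → ℝ}
    (hω : Tendsto ω atTop atTop) (C : ℝ) :
    ∀ᶠ n : ℕ in atTop, (⌈scale q ω n⌉₊ : ℝ) + 1 ≤
      n * (2 : ℝ) ^ (-(C * Real.logb 2 n ^ (1 - 1 / (q : ℝ)))) := by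
  have hroot : Tendsto (fun n : ℕ => Real.logb 2 (n : ℝ) ^ (1 / (q : ℝ))) atTop atTop :=
    (tendsto_rpow_atTop (by positivity)).comp tendsto_logb_two_natCast
  filter_upwards [tendsto_logb_two_natCast.eventually_ge_atTop 1,
    hroot.eventually_ge_atTop (C + 2), hω.eventually_ge_atTop (C + 1),
    eventually_gt_atTop 0] with n hL hLroot hωn hn
  set L : ℝ := Real.logb 2 (n : ℝ) with hLdef
  have hn0 : (0 : ℝ) < n := Nat.cast_pos.mpr hn
  set E : ℝ := L ^ (1 - 1 / (q : ℝ)) with hE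
  have hE1 : 1 ≤ E := Real.one_le_rpow hL (sub_nonneg.mpr
    (div_le_one_of_le₀ (Nat.one_le_cast.mpr (Nat.pos_of_ne_zero hq)) (by positivity)))
  have hEL : E * L ^ (1 / (q : ℝ)) = L := by
    rw [hE, ← Real.rpow_add (by linarith), sub_add_cancel, Real.rpow_one]
  set X : ℝ := n * (2 : ℝ) ^ (-(C * E)) with hX
  have hX4 : 4 ≤ X := by
    have hexponent : 2 ≤ L + -(C * E) := by nlinarith
    calc (4 : ℝ) = 2 ^ (2 : ℝ) := by norm_num
      _ ≤ 2 ^ (L + -(C * E)) := Real.rpow_le_rpow_of_exponent_le one_le_two hexponent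
      _ = X := by
        rw [Real.rpow_add two_pos, hLdef, Real.rpow_logb two_pos (by norm_num) hn0]
  have hscale : scale q ω n ≤ X / 2 := by
    have hexponent : -(ω n * E) ≤ -(C * E) + -1 := by nlinarith
    calc scale q ω n ≤ n * 2 ^ (-(C * E) + -1) :=
          mul_le_mul_of_nonneg_left (Real.rpow_le_rpow_of_exponent_le one_le_two hexponent) hn0.le
      _ = X / 2 := by
          rw [Real.rpow_add two_pos, Real.rpow_neg_one, hX]
          ring
  have hceil := Nat.ceil_lt_add_one (by unfold scale; positivity : 0 ≤ scale q ω n)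
  linarith

theorem eventually_exists_densities (p : ℕ) {q : ℕ} (hq : q ≠ 0) {ω : ℕ → ℝ}
    (hω : Tendsto ω atTop atTop) {δ : ℝ} (hδ : 0 < δ) :
    ∀ᶠ n : ℕ in atTop, ∃ d : ℕ → ℝ, (∀ k, 0 < d k) ∧ d q ≤ δ ∧
      ∀ k, ∃ s : ℕ, ⌈scale q ω n⌉₊ + n.choose p * d k ^ s ≤ n * d (k + 1) ^ s := by
  obtain ⟨c, hc, hcδ⟩ : ∃ c : ℝ, 1 ≤ c ∧ (2 : ℝ) ^ (-c) ≤ δ := by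
    refine ⟨max 1 (-Real.logb 2 δ), le_max_left _ _, ?_⟩
    rw [← Real.le_logb_iff_rpow_le one_lt_two hδ]
    exact neg_le.mp (le_max_right _ _)
  filter_upwards [eventually_ceil_scale_add_one_le hq hω (c * (p + 1)),
    tendsto_logb_two_natCast.eventually_ge_atTop 1, eventually_gt_atTop 0] with n hscale hL hn
  refine ⟨iterDensity c (Real.logb 2 n) q, iterDensity_pos _ _ _,
    (iterDensity_self _ _ hq).trans_le hcδ, fun k => ?_⟩
  obtain ⟨s, hlarge, hsmall⟩ := exists_le_iterDensity_pow hc hL p q k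
  rw [Real.rpow_logb two_pos (by norm_num) (Nat.cast_pos.mpr hn)] at hsmall
  refine ⟨s, ?_⟩
  have hchoose : (n.choose p : ℝ) ≤ n ^ p := by exact_mod_cast Nat.choose_le_pow n p
  calc ⌈scale q ω n⌉₊ + n.choose p * iterDensity c (Real.logb 2 n) q k ^ s
      ≤ ⌈scale q ω n⌉₊ + 1 := by
        gcongr
        exact (mul_le_mul_of_nonneg_right hchoose (pow_nonneg (iterDensity_pos _ _ _ _).le s)).trans
          hsmall
    _ ≤ n * (2 : ℝ) ^ (-(c * (p + 1) * Real.logb 2 n ^ (1 - 1 / (q : ℝ)))) := hscale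
    _ ≤ n * iterDensity c (Real.logb 2 n) q (k + 1) ^ s := by gcongr

end Scale

section UpperBound

theorem indepNum_comap_le {V W : Type*} [Finite V] (G : SimpleGraph V) (f : W ↪ V) :
    (G.comap f).indepNum ≤ G.indepNum := by
  have : Finite W := Finite.of_injective f f.injective
  obtain ⟨s, hs⟩ := (G.comap f).exists_isNIndepSet_indepNum
  rw [← hs.card_eq, ← card_map f]
  refine SimpleGraph.IsIndepSet.card_le_indepNum ?_
  rw [coe_map, SimpleGraph.isIndepSet_iff, f.injective.injOn.pairwise_image]
  exact hs.isIndepSet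

theorem Q_le_indepNum {t n : ℕ} {G : SimpleGraph (Fin n)} (hG : G.CliqueFree t) :
    Q t n ≤ G.indepNum :=
  Nat.sInf_le ⟨G, hG, rfl⟩

theorem exists_isNClique_of_indepNum_lt_Q {V : Type*} [Finite V] {G : SimpleGraph V} {p m : ℕ}
    (hG : G.indepNum < Q p m) {U : Finset V} (hU : m ≤ #U) : ∃ T ⊆ U, G.IsNClique p T := by
  obtain ⟨U', hU'U, hU'⟩ := exists_subset_card_eq hU
  let f : Fin m ↪ V :=
    (U'.equivFinOfCardEq hU').symm.toEmbedding.trans (Function.Embedding.subtype _)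
  have hnot_free : ¬ (G.comap f).CliqueFree p := fun hfree =>
    (indepNum_comap_le G f).not_gt (hG.trans_le (Q_le_indepNum hfree))
  simp only [SimpleGraph.CliqueFree, not_forall, not_not] at hnot_free
  obtain ⟨T, hT⟩ := hnot_free
  refine ⟨T.map f, fun v hv => ?_, hT.map.mono (SimpleGraph.map_comap_le f G)⟩
  obtain ⟨i, -, rfl⟩ := mem_map.mp hv
  exact hU'U (Subtype.coe_prop _)

theorem eventually_ncard_edgeSet_le {p r : ℕ} (hp : p ≠ 0) (hr : 0 < r) {ω : ℕ → ℝ}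
    (hω : Tendsto ω atTop atTop) {ε : ℝ} (hε : 0 < ε) :
    ∀ᶠ n : ℕ in atTop, ∀ G : SimpleGraph (Fin n), G.CliqueFree (p * (r + 1)) →
      G.indepNum < Q p ⌈scale (r + 1) ω n⌉₊ →
        G.edgeSet.ncard ≤ (1 / 2 * (1 - 1 / (r : ℝ)) + ε) * n ^ 2 := by
  classical
  obtain ⟨δ, hδ, hcount⟩ := exists_le_card_cliqueTuples hr hε
  filter_upwards [eventually_exists_densities p r.succ_ne_zero hω hδ, hcount,
    eventually_gt_atTop 0] with n ⟨d, hd, hdδ, hstep⟩ hcount hn G hfree hα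
  by_contra! hedges
  have : NeZero n := ⟨hn.ne'⟩
  obtain ⟨T, -, hT⟩ := exists_isNClique_mul_of_le_card_cliqueTuples hp
    (fun _ hU => exists_isNClique_of_indepNum_lt_Q hα hU) hd (by simpa using hstep)
    (W := univ) (q := r + 1) (G := G) (by
      rw [Fintype.card_fin]
      exact (mul_le_mul_of_nonneg_right hdδ (by positivity)).trans (hcount G hedges.le))
  exact hfree T hT

theorem maxEdges_le {W : Type} {n : ℕ} {H : SimpleGraph W} {x B : ℝ} (hB : 0 ≤ B)
    (h : ∀ G : SimpleGraph (Fin n), H.Free G → (G.indepNum : ℝ) < x →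
      (G.edgeSet.ncard : ℝ) ≤ B) : (maxEdges n H x : ℝ) ≤ B := by
  rw [← Nat.le_floor_iff hB]
  refine csSup_le' ?_
  rintro e ⟨G, hG, hα, rfl⟩
  exact Nat.le_floor (h G hG hα)

theorem ncard_edgeSet_le_maxEdges {W : Type} {n : ℕ} {H : SimpleGraph W} {x : ℝ}
    {G : SimpleGraph (Fin n)} (hG : H.Free G) (hα : (G.indepNum : ℝ) < x) :
    G.edgeSet.ncard ≤ maxEdges n H x := by
  refine le_csSup ⟨Nat.card (Sym2 (Fin n)), ?_⟩ ⟨G, hG, hα, rfl⟩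
  rintro e ⟨G', -, -, rfl⟩
  exact Set.ncard_le_card _

theorem K_free_iff {V : Type*} {s : ℕ} {G : SimpleGraph V} : (K s).Free G ↔ G.CliqueFree s := by
  simpa using (SimpleGraph.cliqueFree_iff_top_free (G := G) (β := Fin s)).symm

theorem eventually_maxEdges_div_le {p r s : ℕ} (hp : p ≠ 0) (hr : 0 < r) (hs : s ≤ p * (r + 1))
    {ω : ℕ → ℝ} (hω : Tendsto ω atTop atTop) {g : ℕ → ℝ}
    (hg : ∀ᶠ n : ℕ in atTop, g n ≤ Q p ⌈scale (r + 1) ω n⌉₊) {ε : ℝ} (hε : 0 < ε) :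
    ∀ᶠ n : ℕ in atTop,
      (maxEdges n (K s) (g n) : ℝ) / n ^ 2 ≤ 1 / 2 * (1 - 1 / (r : ℝ)) + ε := by
  have hr_inv : 0 ≤ 1 - 1 / (r : ℝ) :=
    sub_nonneg.mpr (div_le_one_of_le₀ (Nat.one_le_cast.mpr hr) (by positivity))
  filter_upwards [eventually_ncard_edgeSet_le hp hr hω hε, hg, eventually_gt_atTop 0]
    with n hn hgn hn0
  rw [div_le_iff₀ (by positivity)]
  refine maxEdges_le (by positivity) fun G hG hα => hn G ?_ ?_
  · exact (K_free_iff.mp hG).mono hs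
  · exact Nat.cast_lt.mp (hα.trans_le hgn)

theorem upperDensity_le {p r s : ℕ} (hp : p ≠ 0) (hr : 0 < r) (hs : s ≤ p * (r + 1))
    {ω : ℕ → ℝ} (hω : Tendsto ω atTop atTop) {g : ℕ → ℝ}
    (hg : ∀ᶠ n : ℕ in atTop, g n ≤ Q p ⌈scale (r + 1) ω n⌉₊) :
    upperDensity (K s) g ≤ 1 / 2 * (1 - 1 / (r : ℝ)) := by
  refine le_of_forall_pos_le_add fun ε hε => ?_
  refine limsup_le_of_le ?_ (eventually_maxEdges_div_le hp hr hs hω hg hε)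
  exact isCoboundedUnder_le_of_le atTop (x := 0) fun n => by positivity

end UpperBound

section Chain

variable {X : Type*} (B : SimpleGraph X) (u w : X)

/-- The vertex of `B` underlying a vertex of `chain B u w`. A pair `(j, some x)` is the vertex `x`
of the `j`-th copy of `B`, and `(j, none)` is a twin of `u` in that copy. -/
def proj (z : ℕ × Option X) : X := z.2.getD u

/-- The pairs of vertices in consecutive copies that are not joined in `chain B u w`: in the next
copy, `u` is joined only to the vertices over `w` and its neighbours, the twin of `u` only to the
vertices not over `w`. -/
def Unjoined (a b : ℕ × Option X) : Prop :=
  b.1 = a.1 + 1 ∧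
    (a.2 = some u ∧ proj u b ≠ w ∧ ¬ B.Adj w (proj u b) ∨ a.2 = none ∧ proj u b = w)

/-- Copies of `B`, indexed by `ℕ`, in each of which the vertex `u` is doubled into two adjacent
twins; different copies are joined completely except for the pairs in `Unjoined`. -/
def chain : SimpleGraph (ℕ × Option X) where
  Adj a b := a ≠ b ∧ (a.1 = b.1 → proj u a = proj u b ∨ B.Adj (proj u a) (proj u b)) ∧
    ¬ Unjoined B u w a b ∧ ¬ Unjoined B u w b a
  symm := ⟨fun _ _ h => ⟨h.1.symm, fun hab => (h.2.1 hab.symm).imp Eq.symm SimpleGraph.Adj.symm,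
    h.2.2.2, h.2.2.1⟩⟩
  loopless := ⟨fun _ h => h.1 rfl⟩

variable {B u w}

theorem Unjoined.proj_eq {a b : ℕ × Option X} (h : Unjoined B u w a b) : proj u a = u := by
  rcases h.2 with ⟨ha, -⟩ | ⟨ha, -⟩ <;> simp [proj, ha]

theorem chain_adj_iff_of_fst_eq {a b : ℕ × Option X} (h : a.1 = b.1) :
    (chain B u w).Adj a b ↔ a ≠ b ∧ (proj u a = proj u b ∨ B.Adj (proj u a) (proj u b)) := by
  have hab : ¬ Unjoined B u w a b := fun h' => by have := h'.1; omega
  have hba : ¬ Unjoined B u w b a := fun h' => by have := h'.1; omega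
  simp only [chain, h, hab, hba, forall_const, not_false_eq_true, and_true]

theorem unjoined_of_not_chain_adj {a b : ℕ × Option X} (hlt : a.1 < b.1)
    (h : ¬ (chain B u w).Adj a b) : Unjoined B u w a b := by
  by_contra hab
  refine h ⟨fun heq => hlt.ne (congrArg Prod.fst heq), fun heq => absurd heq hlt.ne, hab,
    fun hba => ?_⟩
  have := hba.1
  omega

theorem chain_adj_of_fst_ne {a b : ℕ × Option X} (h : a.1 ≠ b.1) (ha : proj u a ≠ u)
    (hb : proj u b ≠ u) : (chain B u w).Adj a b :=
  ⟨fun heq => h (congrArg Prod.fst heq), fun heq => absurd heq h, fun hab => ha hab.proj_eq,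
    fun hba => hb hba.proj_eq⟩

theorem proj_injOn {S : Set (ℕ × Option X)} {j : ℕ} (hj : ∀ z ∈ S, z.1 = j)
    (htwins : (j, none) ∈ S → (j, some u) ∉ S) : Set.InjOn (proj u) S := by
  rintro ⟨a, x⟩ ha ⟨b, y⟩ hb hab
  obtain rfl : a = j := hj _ ha
  obtain rfl : b = a := hj _ hb
  cases x <;> cases y <;> simp_all [proj]

theorem proj_injOn_of_isIndepSet {S : Set (ℕ × Option X)} {j : ℕ} (hj : ∀ z ∈ S, z.1 = j)
    (hS : (chain B u w).IsIndepSet S) : Set.InjOn (proj u) S := by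
  intro a ha b hb hab
  by_contra hne
  exact hS ha hb hne
    ((chain_adj_iff_of_fst_eq ((hj a ha).trans (hj b hb).symm)).mpr ⟨hne, Or.inl hab⟩)

theorem isClique_image_proj {S : Set (ℕ × Option X)} {j : ℕ} (hj : ∀ z ∈ S, z.1 = j)
    (hS : (chain B u w).IsClique S) : B.IsClique (proj u '' S) := by
  rintro _ ⟨a, ha, rfl⟩ _ ⟨b, hb, rfl⟩ hab
  have hadj := hS ha hb (ne_of_apply_ne _ hab)
  rw [chain_adj_iff_of_fst_eq ((hj a ha).trans (hj b hb).symm)] at hadj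
  exact hadj.2.resolve_left hab

theorem isIndepSet_image_proj {S : Set (ℕ × Option X)} {j : ℕ} (hj : ∀ z ∈ S, z.1 = j)
    (hS : (chain B u w).IsIndepSet S) : B.IsIndepSet (proj u '' S) := by
  rintro _ ⟨a, ha, rfl⟩ _ ⟨b, hb, rfl⟩ hab hadj
  have hne : a ≠ b := ne_of_apply_ne _ hab
  exact hS ha hb hne
    ((chain_adj_iff_of_fst_eq ((hj a ha).trans (hj b hb).symm)).mpr ⟨hne, Or.inr hadj⟩)

theorem card_succ_le_cliqueNum [Finite X] {T : Finset X} {v : X} (hT : B.IsClique T)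
    (hv : ∀ x ∈ T, B.Adj v x) : #T + 1 ≤ B.cliqueNum := by
  classical
  rw [← card_insert_of_notMem fun hvT => (hv v hvT).ne rfl]
  refine SimpleGraph.IsClique.card_le_cliqueNum (tc := ?_)
  rw [coe_insert]
  exact hT.insert fun x hx _ => hv x hx

theorem card_succ_le_indepNum [Finite X] {T : Finset X} {v : X} (hT : B.IsIndepSet T)
    (hv : ∀ x ∈ T, x ≠ v ∧ ¬ B.Adj v x) : #T + 1 ≤ B.indepNum := by
  rw [← SimpleGraph.cliqueNum_compl]
  exact card_succ_le_cliqueNum ((B.isClique_compl).mpr hT)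
    fun x hx => (SimpleGraph.compl_adj ..).mpr ⟨(hv x hx).1.symm, (hv x hx).2⟩

theorem card_le_cliqueNum_of_fst_eq [Finite X] {S : Finset (ℕ × Option X)} {j : ℕ}
    (hj : ∀ z ∈ S, z.1 = j) (hS : (chain B u w).IsClique S)
    (htwins : (j, none) ∈ S → (j, some u) ∉ S) : #S ≤ B.cliqueNum := by
  classical
  rw [← card_image_of_injOn (proj_injOn hj htwins)]
  refine SimpleGraph.IsClique.card_le_cliqueNum (tc := ?_)
  rw [coe_image]
  exact isClique_image_proj hj hS

theorem card_le_cliqueNum_succ_of_fst_eq [Finite X] {S : Finset (ℕ × Option X)} {j : ℕ}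
    (hj : ∀ z ∈ S, z.1 = j) (hS : (chain B u w).IsClique S) : #S ≤ B.cliqueNum + 1 := by
  classical
  have herase : #(S.erase (j, none)) ≤ B.cliqueNum :=
    card_le_cliqueNum_of_fst_eq (fun z hz => hj z (mem_of_mem_erase hz))
      (hS.subset (coe_subset.mpr (erase_subset _ _))) fun h => absurd h (notMem_erase _ _)
  have := pred_card_le_card_erase (s := S) (a := (j, none))
  omega

theorem card_succ_le_cliqueNum_of_fst_eq [Finite X] (hwu : ¬ B.Adj w u)
    {S : Finset (ℕ × Option X)} {j : ℕ} (hj : ∀ z ∈ S, z.1 = j)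
    (hS : (chain B u w).IsClique S) (hadj : ∀ z ∈ S, B.Adj w (proj u z)) :
    #S + 1 ≤ B.cliqueNum := by
  classical
  rw [← card_image_of_injOn (proj_injOn hj fun h => absurd (hadj _ h) hwu)]
  refine card_succ_le_cliqueNum (v := w) ?_ (forall_mem_image.mpr hadj)
  rw [coe_image]
  exact isClique_image_proj hj hS

theorem card_le_indepNum_of_fst_eq [Finite X] {S : Finset (ℕ × Option X)} {j : ℕ}
    (hj : ∀ z ∈ S, z.1 = j) (hS : (chain B u w).IsIndepSet S) : #S ≤ B.indepNum := by
  classical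
  rw [← card_image_of_injOn (proj_injOn_of_isIndepSet hj hS)]
  refine SimpleGraph.IsIndepSet.card_le_indepNum ?_
  rw [coe_image]
  exact isIndepSet_image_proj hj hS

theorem card_succ_le_indepNum_of_fst_eq [Finite X] {S : Finset (ℕ × Option X)} {j : ℕ}
    (hj : ∀ z ∈ S, z.1 = j) (hS : (chain B u w).IsIndepSet S) {v : X}
    (hv : ∀ z ∈ S, proj u z ≠ v ∧ ¬ B.Adj v (proj u z)) : #S + 1 ≤ B.indepNum := by
  classical
  rw [← card_image_of_injOn (proj_injOn_of_isIndepSet hj hS)]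
  refine card_succ_le_indepNum (v := v) ?_ (forall_mem_image.mpr hv)
  rw [coe_image]
  exact isIndepSet_image_proj hj hS

theorem adj_proj_of_twins_mem {S : Set (ℕ × Option X)} (hS : (chain B u w).IsClique S) {j : ℕ}
    (hnone : (j, none) ∈ S) (hsome : (j, some u) ∈ S) {z : ℕ × Option X} (hz : z ∈ S)
    (hzj : z.1 = j + 1) : B.Adj w (proj u z) := by
  have hne (o : Option X) : (j, o) ≠ z := fun h => by
    have := congrArg Prod.fst h
    simp only at this
    omega
  have hproj : proj u z ≠ w := fun h =>
    (hS hnone hz (hne _)).2.2.1 ⟨hzj, Or.inr ⟨rfl, h⟩⟩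
  by_contra hadj
  exact (hS hsome hz (hne _)).2.2.1 ⟨hzj, Or.inl ⟨rfl, hproj, hadj⟩⟩

theorem sum_range_succ_le_of_drop {t : ℕ} {s : ℕ → ℕ} (hle : ∀ j, s j ≤ t + 1)
    (hdrop : ∀ j, t < s j → s (j + 1) + 1 ≤ t) (k : ℕ) :
    ∑ j ∈ range (k + 1), s j ≤ t * k + max t (s k) := by
  induction k with
  | zero => simp
  | succ k ih =>
    rw [sum_range_succ, mul_add, mul_one]
    have := hle k
    rcases le_or_gt (s k) t with h | h
    · rw [max_eq_left h] at ih; omega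
    · have := hdrop k h
      rw [max_eq_right h.le] at ih; omega

theorem card_le_of_isClique_chain [Finite X] (hwu : ¬ B.Adj w u) {r : ℕ}
    {S : Finset (ℕ × Option X)} (hS : (chain B u w).IsClique S) (hr : ∀ z ∈ S, z.1 < r + 1)
    (hlast : (r, none) ∉ S) : #S ≤ B.cliqueNum * (r + 1) := by
  have hfst (j : ℕ) : ∀ z ∈ ({z ∈ S | z.1 = j} : Finset _), z.1 = j :=
    fun z hz => (mem_filter.mp hz).2
  have hclique (j : ℕ) : (chain B u w).IsClique ({z ∈ S | z.1 = j} : Finset _) :=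
    hS.subset (coe_subset.mpr (filter_subset _ _))
  have hdrop (j : ℕ) (hj : B.cliqueNum < #{z ∈ S | z.1 = j}) :
      #{z ∈ S | z.1 = j + 1} + 1 ≤ B.cliqueNum := by
    have htwins : (j, none) ∈ S ∧ (j, some u) ∈ S := by
      by_contra h
      exact hj.not_ge (card_le_cliqueNum_of_fst_eq (hfst j) (hclique j) (by simpa using h))
    refine card_succ_le_cliqueNum_of_fst_eq hwu (hfst _) (hclique _) fun z hz => ?_
    exact adj_proj_of_twins_mem hS htwins.1 htwins.2 (mem_filter.mp hz).1 (mem_filter.mp hz).2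
  have hlast_le : #{z ∈ S | z.1 = r} ≤ B.cliqueNum :=
    card_le_cliqueNum_of_fst_eq (hfst r) (hclique r) fun h => absurd (mem_filter.mp h).1 hlast
  calc #S = ∑ j ∈ range (r + 1), #{z ∈ S | z.1 = j} :=
        card_eq_sum_card_fiberwise fun z hz => by simpa using hr z hz
    _ ≤ B.cliqueNum * r + max B.cliqueNum #{z ∈ S | z.1 = r} := sum_range_succ_le_of_drop
        (fun j => card_le_cliqueNum_succ_of_fst_eq (hfst j) (hclique j)) hdrop r
    _ = B.cliqueNum * (r + 1) := by rw [max_eq_left hlast_le, mul_add, mul_one]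

theorem unjoined_of_isIndepSet {S : Set (ℕ × Option X)} (hS : (chain B u w).IsIndepSet S)
    {a b : ℕ × Option X} (ha : a ∈ S) (hb : b ∈ S) (hlt : a.1 < b.1) : Unjoined B u w a b :=
  unjoined_of_not_chain_adj hlt (hS ha hb fun h => hlt.ne (congrArg Prod.fst h))

theorem eq_of_unjoined_of_unjoined {a b c : ℕ × Option X} (hab : Unjoined B u w a b)
    (hcb : Unjoined B u w c b) : a = c := by
  have hfst : a.1 = c.1 := by have := hab.1; have := hcb.1; omega
  refine Prod.ext hfst ?_
  rcases hab.2 with ⟨ha, hb, -⟩ | ⟨ha, hb⟩ <;> rcases hcb.2 with ⟨hc, hb', -⟩ | ⟨hc, hb'⟩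
  · exact ha.trans hc.symm
  · exact absurd hb' hb
  · exact absurd hb hb'
  · exact ha.trans hc.symm

theorem eq_or_fst_eq_of_isIndepSet {S : Set (ℕ × Option X)} (hS : (chain B u w).IsIndepSet S)
    {a b : ℕ × Option X} (ha : a ∈ S) (hb : b ∈ S) (hlt : a.1 < b.1) {z : ℕ × Option X}
    (hz : z ∈ S) : z = a ∨ z.1 = b.1 := by
  have hab := unjoined_of_isIndepSet hS ha hb hlt
  have hab_fst := hab.1
  rcases lt_or_ge z.1 b.1 with hzb | hbz
  · exact Or.inl (eq_of_unjoined_of_unjoined (unjoined_of_isIndepSet hS hz hb hzb) hab)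
  · have := (unjoined_of_isIndepSet hS ha hz (hlt.trans_le hbz)).1
    exact Or.inr (by omega)

theorem exists_forall_ne_and_not_adj_of_unjoined (hne : u ≠ w) (huw : ¬ B.Adj u w)
    (a : ℕ × Option X) :
    ∃ v, ∀ z, Unjoined B u w a z → proj u z ≠ v ∧ ¬ B.Adj v (proj u z) := by
  rcases ha : a.2 with _ | x
  · refine ⟨u, fun z hz => ?_⟩
    rcases hz.2 with ⟨hax, -⟩ | ⟨-, hzw⟩
    · simp [ha] at hax
    · rw [hzw]
      exact ⟨hne.symm, huw⟩
  · refine ⟨w, fun z hz => ?_⟩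
    rcases hz.2 with ⟨-, hzw⟩ | ⟨hax, -⟩
    · exact hzw
    · simp [ha] at hax

theorem card_le_indepNum_of_isIndepSet_chain [Finite X] (hne : u ≠ w) (huw : ¬ B.Adj u w)
    {S : Finset (ℕ × Option X)} (hS : (chain B u w).IsIndepSet S) : #S ≤ B.indepNum := by
  classical
  by_cases hcross : ∃ a ∈ S, ∃ b ∈ S, a.1 < b.1
  · obtain ⟨a, ha, b, hb, hlt⟩ := hcross
    obtain ⟨v, hv⟩ := exists_forall_ne_and_not_adj_of_unjoined hne huw a
    have hsub : S ⊆ insert a {z ∈ S | z.1 = b.1} := fun z hz => mem_insert.mpr <|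
      (eq_or_fst_eq_of_isIndepSet hS ha hb hlt hz).imp_right fun h => mem_filter.mpr ⟨hz, h⟩
    calc #S ≤ #{z ∈ S | z.1 = b.1} + 1 := (card_le_card hsub).trans (card_insert_le _ _)
      _ ≤ B.indepNum := by
        refine card_succ_le_indepNum_of_fst_eq (fun z hz => (mem_filter.mp hz).2)
          (hS.mono (coe_subset.mpr (filter_subset _ _))) (v := v) fun z hz => ?_
        obtain ⟨hzS, hzb⟩ := mem_filter.mp hz
        exact hv z (unjoined_of_isIndepSet hS ha hzS (hlt.trans_eq hzb.symm))
  · push Not at hcross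
    rcases S.eq_empty_or_nonempty with rfl | ⟨a, ha⟩
    · simp
    · exact card_le_indepNum_of_fst_eq
        (fun z hz => le_antisymm (hcross a ha z hz) (hcross z hz a ha)) hS

end Chain

section LowerBound

variable {V X : Type*} {B : SimpleGraph X} {u w : X}

theorem card_filter_fst_eq_le [Fintype V] [Fintype X] (f : V ↪ ℕ × Option X) (j : ℕ) :
    #{y | (f y).1 = j} ≤ Fintype.card X + 1 := by
  rw [← Fintype.card_option, ← card_univ]
  refine card_le_card_of_injOn (fun y => (f y).2) (fun _ _ => mem_univ _) fun y hy z hz hyz => ?_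
  have hyj : (f y).1 = j := by simpa using hy
  have hzj : (f z).1 = j := by simpa using hz
  exact f.injective (Prod.ext (hyj.trans hzj.symm) hyz)

theorem card_filter_proj_eq_le [Fintype V] [DecidableEq X] (f : V ↪ ℕ × Option X) {r : ℕ}
    (hf : ∀ x, (f x).1 < r) (u : X) :
    #{y | proj u (f y) = u} ≤ 2 * r := by
  calc #{y | proj u (f y) = u} ≤ #(range r ×ˢ ({none, some u} : Finset (Option X))) := by
        refine card_le_card_of_injOn f (fun y hy => ?_) f.injective.injOn
        have hyu : (f y).2.getD u = u := (mem_filter_univ y).mp (mem_coe.mp hy)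
        rw [mem_coe, mem_product]
        refine ⟨mem_range.mpr (hf y), ?_⟩
        cases h : (f y).2 <;> simp_all
    _ ≤ r * 2 := by rw [card_product, card_range]; exact Nat.mul_le_mul_left _ card_le_two
    _ = 2 * r := mul_comm _ _

theorem card_le_card_adj_comap_chain_add [Fintype V] [Fintype X]
    [DecidableRel (chain B u w).Adj] (f : V ↪ ℕ × Option X) {r : ℕ}
    (hf : ∀ x, (f x).1 < r) {v : V} (hv : proj u (f v) ≠ u) :
    Fintype.card V ≤
      #{y | ((chain B u w).comap f).Adj v y} + (Fintype.card X + 1) + 2 * r := by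
  classical
  have hcover : (univ : Finset V) ⊆
      ({y | ((chain B u w).comap f).Adj v y} : Finset V) ∪ ({y | (f y).1 = (f v).1} : Finset V) ∪
        ({y | proj u (f y) = u} : Finset V) := by
    intro y _
    simp only [mem_union, mem_filter_univ]
    by_contra! h
    exact h.1.1 (chain_adj_of_fst_ne (Ne.symm h.1.2) hv h.2)
  calc Fintype.card V ≤ _ := card_le_card hcover
    _ ≤ _ := (card_union_le _ _).trans (Nat.add_le_add_right (card_union_le _ _) _)
    _ ≤ _ := by
      gcongr
      exacts [card_filter_fst_eq_le f _, card_filter_proj_eq_le f hf u]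

theorem card_sq_le_two_mul_ncard_edgeSet_comap_chain [Fintype V] [Fintype X]
    (f : V ↪ ℕ × Option X) {r : ℕ} (hf : ∀ x, (f x).1 < r) :
    Fintype.card V ^ 2 ≤ 2 * ((chain B u w).comap f).edgeSet.ncard +
      Fintype.card V * (Fintype.card X + 1 + 4 * r) := by
  classical
  have hdeg (v : V) : Fintype.card V ≤ #{y | ((chain B u w).comap f).Adj v y} +
      (Fintype.card X + 1 + 2 * r) + if proj u (f v) = u then Fintype.card V else 0 := by
    split_ifs with hv
    · exact Nat.le_add_left _ _
    · exact (card_le_card_adj_comap_chain_add f hf hv).trans_eq (add_assoc _ _ _)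
  calc Fintype.card V ^ 2 = ∑ _v : V, Fintype.card V := by
        rw [sum_const, card_univ, smul_eq_mul, sq]
    _ ≤ ∑ v, (#{y | ((chain B u w).comap f).Adj v y} + (Fintype.card X + 1 + 2 * r) +
          if proj u (f v) = u then Fintype.card V else 0) := sum_le_sum fun v _ => hdeg v
    _ = 2 * ((chain B u w).comap f).edgeSet.ncard +
          Fintype.card V * (Fintype.card X + 1 + 2 * r) +
            #{v | proj u (f v) = u} * Fintype.card V := by
        rw [sum_add_distrib, sum_add_distrib, sum_card_adj_eq_two_mul_ncard_edgeSet, sum_const,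
          card_univ, smul_eq_mul, ← sum_filter, sum_const, smul_eq_mul]
    _ ≤ 2 * ((chain B u w).comap f).edgeSet.ncard +
          Fintype.card V * (Fintype.card X + 1 + 2 * r) + 2 * r * Fintype.card V := by
        gcongr
        exact card_filter_proj_eq_le f hf u
    _ = 2 * ((chain B u w).comap f).edgeSet.ncard +
          Fintype.card V * (Fintype.card X + 1 + 4 * r) := by ring

theorem exists_embedding_fst_lt (n k : ℕ) :
    ∃ f : Fin n ↪ ℕ × Option (Fin (n / (k + 1))),
      (∀ x, (f x).1 < k + 1) ∧ ∀ x, f x ≠ (k, none) := by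
  classical
  let A : Finset (ℕ × Option (Fin (n / (k + 1)))) := (range (k + 1) ×ˢ univ).erase (k, none)
  have hA : Fintype.card (Fin n) ≤ Fintype.card A := by
    rw [Fintype.card_fin, Fintype.card_coe, card_erase_of_mem (by simp), card_product, card_range,
      card_univ, Fintype.card_option, Fintype.card_fin]
    exact Nat.le_sub_one_of_lt (Nat.lt_mul_div_succ n k.succ_pos)
  obtain ⟨f⟩ := Function.Embedding.nonempty_of_card_le hA
  refine ⟨f.trans (Function.Embedding.subtype _), fun x => ?_, fun x => ?_⟩
  · exact mem_range.mp (mem_product.mp (mem_of_mem_erase (f x).2)).1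
  · exact ne_of_mem_erase (f x).2

theorem cliqueFree_comap_chain [Finite X] (hwu : ¬ B.Adj w u) {k : ℕ} {f : V ↪ ℕ × Option X}
    (hf : ∀ x, (f x).1 < k + 1) (hlast : ∀ x, f x ≠ (k, none)) :
    ((chain B u w).comap f).CliqueFree (B.cliqueNum * (k + 1) + 1) := by
  intro S hS
  have hclique : (chain B u w).IsClique (S.map f) := by
    rw [coe_map]
    exact hS.isClique.map.mono (SimpleGraph.map_comap_le f _)
  have hcard : #(S.map f) ≤ B.cliqueNum * (k + 1) :=
    card_le_of_isClique_chain hwu hclique (forall_mem_map.mpr fun x _ => hf x) (by simp [hlast])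
  rw [card_map, hS.card_eq] at hcard
  omega

theorem indepNum_comap_chain_le [Finite X] (hne : u ≠ w) (huw : ¬ B.Adj u w)
    (f : V ↪ ℕ × Option X) :
    ((chain B u w).comap f).indepNum ≤ B.indepNum := by
  obtain ⟨S, hS⟩ := ((chain B u w).comap f).exists_isNIndepSet_indepNum
  rw [← hS.card_eq, ← card_map f]
  refine card_le_indepNum_of_isIndepSet_chain hne huw ?_
  rw [coe_map, SimpleGraph.isIndepSet_iff, f.injective.injOn.pairwise_image]
  exact hS.isIndepSet

theorem exists_cliqueFree_indepNum_eq_Q {t : ℕ} (ht : 1 ≤ t) (m : ℕ) :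
    ∃ B : SimpleGraph (Fin m), B.CliqueFree (t + 1) ∧ B.indepNum = Q (t + 1) m :=
  Nat.sInf_mem (s := {a | ∃ G : SimpleGraph (Fin m), G.CliqueFree (t + 1) ∧ G.indepNum = a})
    ⟨_, ⊥, SimpleGraph.cliqueFree_bot (by omega), rfl⟩

theorem exists_ne_not_adj_of_cliqueFree [Fintype X] {n : ℕ} (hB : B.CliqueFree n)
    (hn : n ≤ Fintype.card X) : ∃ u w, u ≠ w ∧ ¬ B.Adj u w := by
  by_contra! h
  exact hB.mono hn univ ⟨fun a _ b _ hab => h a b hab, card_univ⟩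

theorem cliqueNum_le_of_cliqueFree {t : ℕ} (hB : B.CliqueFree (t + 1)) : B.cliqueNum ≤ t := by
  obtain ⟨S, hS⟩ := B.exists_isNClique_cliqueNum
  by_contra! h
  exact hB.mono h S hS

theorem exists_dense_cliqueFree {t r n : ℕ} (ht : 1 ≤ t) (hr : 0 < r) (hn : t < n / r) :
    ∃ G : SimpleGraph (Fin n), G.CliqueFree (t * r + 1) ∧ G.indepNum ≤ Q (t + 1) (n / r) ∧
      (n : ℝ) ^ 2 * (1 - 1 / r) ≤ 2 * G.edgeSet.ncard + (4 * r + 1) * n := by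
  obtain ⟨k, rfl⟩ := Nat.exists_eq_add_one.mpr hr
  obtain ⟨B, hB, hBα⟩ := exists_cliqueFree_indepNum_eq_Q ht (n / (k + 1))
  obtain ⟨u, w, hne, huw⟩ := exists_ne_not_adj_of_cliqueFree hB (by simpa using hn)
  obtain ⟨f, hf, hlast⟩ := exists_embedding_fst_lt n k
  refine ⟨(chain B u w).comap f, ?_, ?_, ?_⟩
  · refine (cliqueFree_comap_chain (fun h => huw h.symm) hf hlast).mono ?_
    gcongr
    exact cliqueNum_le_of_cliqueFree hB
  · exact (indepNum_comap_chain_le hne huw f).trans_eq hBα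
  · have hcard := card_sq_le_two_mul_ncard_edgeSet_comap_chain (B := B) (u := u) (w := w) f hf
    rw [Fintype.card_fin, Fintype.card_fin] at hcard
    generalize ((chain B u w).comap f).edgeSet.ncard = e at hcard ⊢
    have hdiv : (n : ℝ) * (n / (k + 1) : ℕ) ≤ n * (n / (k + 1 : ℕ)) := by
      gcongr
      exact Nat.cast_div_le
    have hcard' : (n : ℝ) ^ 2 ≤ 2 * e + n * ((n / (k + 1) : ℕ) + 1 + 4 * (k + 1 : ℕ)) := by
      exact_mod_cast hcard
    linear_combination hcard' + hdiv

theorem eventually_le_maxEdges_div {t r s : ℕ} (ht : 1 ≤ t) (hr : 0 < r) (hs : t * r < s)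
    {g : ℕ → ℝ} (hg : ∀ᶠ n : ℕ in atTop, Q (t + 1) (n / r) < g n) {ε : ℝ} (hε : 0 < ε) :
    ∀ᶠ n : ℕ in atTop,
      1 / 2 * (1 - 1 / (r : ℝ)) - ε ≤ (maxEdges n (K s) (g n) : ℝ) / n ^ 2 := by
  filter_upwards [hg, (Nat.tendsto_div_const_atTop hr.ne').eventually_gt_atTop t,
    tendsto_natCast_atTop_atTop.eventually_ge_atTop ((4 * (r : ℝ) + 1) / (2 * ε)),
    eventually_gt_atTop 0] with n hgn hn hnε hn0
  obtain ⟨G, hG, hGα, hGe⟩ := exists_dense_cliqueFree ht hr hn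
  have hmax : (G.edgeSet.ncard : ℝ) ≤ maxEdges n (K s) (g n) :=
    Nat.cast_le.mpr <| ncard_edgeSet_le_maxEdges (K_free_iff.mpr (hG.mono hs))
      ((Nat.cast_le.mpr hGα).trans_lt hgn)
  rw [div_le_iff₀ (by positivity)] at hnε
  have herror : (4 * (r : ℝ) + 1) * n ≤ n * (2 * ε) * n := by gcongr
  rw [le_div_iff₀ (by positivity)]
  linear_combination (hGe + herror) / 2 + hmax

theorem hasDensity_K {p r t s : ℕ} (hp : p ≠ 0) (hr : 0 < r) (ht : 1 ≤ t)
    (hs : s ≤ p * (r + 1)) (hts : t * r < s) {ω : ℕ → ℝ} (hω : Tendsto ω atTop atTop)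
    {g : ℕ → ℝ} (hg_lower : ∀ᶠ n : ℕ in atTop, Q (t + 1) (n / r) < g n)
    (hg_upper : ∀ᶠ n : ℕ in atTop, g n ≤ Q p ⌈scale (r + 1) ω n⌉₊) :
    HasDensity (K s) g (1 / 2 * (1 - 1 / (r : ℝ))) := by
  have htendsto : Tendsto (fun n : ℕ => (maxEdges n (K s) (g n) : ℝ) / n ^ 2) atTop
      (𝓝 (1 / 2 * (1 - 1 / (r : ℝ)))) := by
    refine Metric.nhds_basis_closedBall.tendsto_right_iff.mpr fun ε hε => ?_
    filter_upwards [eventually_le_maxEdges_div ht hr hts hg_lower hε,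
      eventually_maxEdges_div_le hp hr hs hω hg_upper hε] with n hlower hupper
    rw [Real.closedBall_eq_Icc]
    exact ⟨hlower, hupper⟩
  exact ⟨htendsto.limsup_eq, htendsto.liminf_eq⟩

end LowerBound

end RamseyTuran

theorem mainTheorem3 (p q : ℕ) (hp : 2 ≤ p) (hq : 2 ≤ q) (ω : ℕ → ℝ)
    (hω : Filter.Tendsto ω Filter.atTop Filter.atTop) :
    RamseyTuran.upperDensity (RamseyTuran.K (p * q))
        (fun n => (RamseyTuran.Q p ⌈RamseyTuran.scale q ω n⌉₊ : ℝ))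
      ≤ 1 / 2 * (1 - 1 / ((q : ℝ) - 1)) ∧
    ∀ i t : ℕ, i ≤ p - 1 → t = (p * q - i - 1) / (q - 1) →
      p ≤ t ∧
      ∀ g : ℕ → ℝ,
        (∀ᶠ n : ℕ in Filter.atTop,
          (RamseyTuran.Q (t + 1) (n / (q - 1)) : ℝ) < g n ∧
          g n ≤ (RamseyTuran.Q p ⌈RamseyTuran.scale q ω n⌉₊ : ℝ)) →
        RamseyTuran.HasDensity (RamseyTuran.K (p * q - i)) g
          (1 / 2 * (1 - 1 / ((q : ℝ) - 1))) := by
  obtain ⟨r, rfl⟩ : ∃ r, q = r + 1 := ⟨q - 1, by omega⟩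
  have hp0 : p ≠ 0 := by omega
  have hr : 0 < r := by omega
  simp only [Nat.add_sub_cancel, Nat.cast_add, Nat.cast_one, add_sub_cancel_right]
  refine ⟨RamseyTuran.upperDensity_le hp0 hr le_rfl hω (.of_forall fun _ => le_rfl),
    fun i t hi ht => ?_⟩
  have hmul : p * (r + 1) = p * r + p := Nat.mul_succ p r
  have hpt : p ≤ t := by
    rw [ht, Nat.le_div_iff_mul_le hr]
    omega
  have hts : t * r < p * (r + 1) - i := by
    have := Nat.div_mul_le_self (p * (r + 1) - i - 1) r
    rw [← ht] at this
    omega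
  refine ⟨hpt, fun g hg => ?_⟩
  obtain ⟨hg_lower, hg_upper⟩ := Filter.eventually_and.mp hg
  exact RamseyTuran.hasDensity_K hp0 hr (by omega) (Nat.sub_le _ _) hts hω hg_lower hg_upper
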